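/- **Universal SAT approximation property.** Let $k,n,m\in\mathbb N$ and let $\mathcal L^k_{\mathtt{CNF}}(n,m)$ be the set of $k$-CNF formulae $\phi$ with at most $m$ clauses in which at most $n$ propositional letters occur; a formula is a finite set of clauses, and each clause is a set of exactly $k$ literals in which no letter occurs twice. *MILP-graph.* For such a $\phi$ with clauses $C_1,\dots,C_{m'}$ and occurring letters $p_1,\dots,p_{n'}$, let $E_{ij}=1$ if $p_j\in C_i$, $E_{ij}=-1$ if $\neg p_j\in C_i$ and $E_{ij}=0$ otherwise, and let $b_i=1-\#\{\text{negative literals of }C_i\}$, so that $\phi$ is encoded by the problem $Ex\ge b$, $x\in\{0,1\}^{n'}$. The graph $G_\phi$ is the weighted bipartite graph with constraint nodes $v_1,\dots,v_{m'}$, variable nodes $w_1,\dots,w_{n'}$, edge weights $E_{ij}$, feature $b_i$ at $v_i$, and the empty feature at each $w_j$. *GNN with random node initialization.* Such a GNN appends to the feature vector of every node a random value, these values being independent and uniform on $[0,1]$, which gives $x^V_i=(b_i,\omega_i)$ and $x^W_j=(\omega'_j)$, and then computes $$h^{1,V}_i=f^V_{\rm in}(x^V_i),\qquad h^{1,W}_j=f^W_{\rm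 in}(x^W_j),$$ $$h^{t+1,V}_i=g^V_{t+1}\Big(h^{t,V}_i,\sum_{j}E_{ij}f^W_{t+1}(h^{t,W}_j)\Big),\qquad h^{t+1,W}_j=g^W_{t+1}\Big(h^{t,W}_j,\sum_{i}E_{ij}f^V_{t+1}(h^{t,V}_i)\Big)\qquad(1\le t<l),$$ $$\hat y=f_{\rm out}\Big(\sum_i h^{l,V}_i,\ \sum_j h^{l,W}_j\Big)\in\mathbb R .$$ The number $l\ge1$ of layers, the embedding dimension $d$ and the continuous functions $f^V_{\rm in}:\mathbb R^2\to\mathbb R^d$, $f^W_{\rm in}:\mathbb R\to\mathbb R^d$, $f^V_t,f^W_t:\mathbb R^d\to\mathbb R^d$, $g^V_t,g^W_t:\mathbb R^d\times\mathbb R^d\to\mathbb R^d$, $f_{\rm out}:\mathbb R^d\times\mathbb R^d\to\mathbb R$ specify the GNN; they are the same for all input formulae. Write $F(\phi)$ for the random variable $\hat y$ obtained on $G_\phi$. Then $F$ predicts $\phi$ to be satisfiable if $F(\phi)>\tfrac12$ and unsatisfiable if $F(\phi)\le\tfrac12$; it misclassifies $\phi$ if this prediction is wrong. *Claim.* For every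 finite dataset $\mathcal D\subseteq\mathcal L^k_{\mathtt{CNF}}(n,m)$ and every $\varepsilon>0$ there is a GNN with random node initialization $F$ such that, for every $\phi\in\mathcal D$, $$\Pr\big(F\text{ misclassifies }\phi\big)<\varepsilon .$$ -/

import Mathlib

open MeasureTheory

noncomputable section

namespace MilpSat

/-! ### k-CNF formulae -/

/-- A literal over the letters `P`: `(p, true)` is `p`, and `(p, false)` is `¬ p`. -/
abbrev Literal (P : Type*) := P × Bool

/-- A clause, as the finite set of its literals. -/
abbrev Clause (P : Type*) := Finset (Literal P)

/-- `C` is a `k`-clause: it has `k` literals and no letter occurs more than once in it. -/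
def IsKClause {P : Type*} (k : ℕ) (C : Clause P) : Prop :=
  C.card = k ∧ ∀ l ∈ C, ∀ l' ∈ C, l.1 = l'.1 → l = l'

/-- The finite set of letters occurring in a finite set of clauses. -/
def letters {P : Type*} [DecidableEq P] (φ : Finset (Clause P)) : Finset P :=
  φ.biUnion fun C => C.image Prod.fst

/-- The `k`-CNF formulae (as finite sets of clauses) over the letters `P` in which at most `n`
letters occur and which have at most `m` clauses. -/
structure KCNF (P : Type*) [DecidableEq P] (k n m : ℕ) where
  clauses : Finset (Clause P)
  isKClause : ∀ C ∈ clauses, IsKClause k C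
  card_letters_le : (letters clauses).card ≤ n
  card_clauses_le : clauses.card ≤ m

/-- The world `w` satisfies every clause, i.e. makes some literal of every clause true. -/
def Models {P : Type*} (w : P → Bool) (φ : Finset (Clause P)) : Prop :=
  ∀ C ∈ φ, ∃ l ∈ C, w l.1 = l.2

def Satisfiable {P : Type*} (φ : Finset (Clause P)) : Prop :=
  ∃ w : P → Bool, Models w φ

open Classical in
/-- The classification function: `1` on satisfiable formulae and `0` on the others. -/
def satLabel {P : Type*} [DecidableEq P] {k n m : ℕ} (φ : KCNF P k n m) : Fin 2 :=
  if Satisfiable φ.clauses then 1 else 0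

/-! ### From formulae to MILPs -/

/-- A MILP feasibility problem `A x ≥ b`, `x ∈ {0,1}^W`, with constraints indexed by `V`. -/
structure BinaryMILP (V W : Type*) where
  A : Matrix V W ℝ
  b : V → ℝ

/-- The indices of the constraints of the MILP of `φ`: the clauses of `φ`. -/
abbrev KCNF.Constr {P : Type*} [DecidableEq P] {k n m : ℕ} (φ : KCNF P k n m) :=
  {C : Clause P // C ∈ φ.clauses}

/-- The indices of the variables of the MILP of `φ`: the letters occurring in `φ`. -/
abbrev KCNF.Var {P : Type*} [DecidableEq P] {k n m : ℕ} (φ : KCNF P k n m) :=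
  {p : P // p ∈ letters φ.clauses}

/-- The MILP of `φ`. The clause `C` becomes `∑ l ∈ C, τ l ≥ 1` with `τ p = x p` and
`τ (¬ p) = 1 - x p`; with the constants moved to the right, the coefficient of `x p` is `1`, `-1`
or `0`, and the right-hand side is `1` minus the number of negative literals of `C`. -/
def KCNF.milp {P : Type*} [DecidableEq P] {k n m : ℕ} (φ : KCNF P k n m) :
    BinaryMILP φ.Constr φ.Var where
  A := fun C p =>
    if (p.1, true) ∈ C.1 then 1 else if (p.1, false) ∈ C.1 then -1 else 0
  b := fun C => 1 - ((C.1.filter fun l => l.2 = false).card : ℝ)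

/-! ### Weighted bipartite graphs -/

/-- A weighted bipartite graph with constraint nodes `V` and variable nodes `W`, edge weights `E`
(weight `0` meaning that there is no edge), and node features of dimension `a` on `V` and
`b` on `W`. -/
structure BipGraph (V W : Type*) (a b : ℕ) where
  E : V → W → ℝ
  featV : V → Fin a → ℝ
  featW : W → Fin b → ℝ

/-- The graph of a MILP: the weights are the entries of `A`, the feature of the constraint node
`i` is `b i`, and variable nodes have no feature. -/
def BinaryMILP.graph {V W : Type*} (M : BinaryMILP V W) : BipGraph V W 1 0 where
  E := M.A
  featV := fun i => ![M.b i]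
  featW := fun _ => ![]

/-- The MILP-graph of a formula. -/
def KCNF.graph {P : Type*} [DecidableEq P] {k n m : ℕ} (φ : KCNF P k n m) :
    BipGraph φ.Constr φ.Var 1 0 :=
  φ.milp.graph

/-- Random node initialisation with the values `ω`: the feature vector of each node is extended by
the additional value that `ω` gives to the node. -/
def BipGraph.addFeature {V W : Type*} {a b : ℕ} (G : BipGraph V W a b) (ω : V ⊕ W → ℝ) :
    BipGraph V W (a + 1) (b + 1) where
  E := G.E
  featV := fun i => Fin.snoc (G.featV i) (ω (Sum.inl i))
  featW := fun j => Fin.snoc (G.featW j) (ω (Sum.inr j))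

/-! ### Graph neural networks -/

/-- The functions of one message-passing update with embedding dimension `d`. -/
structure Layer (d : ℕ) where
  fV : (Fin d → ℝ) → (Fin d → ℝ)
  fW : (Fin d → ℝ) → (Fin d → ℝ)
  gV : (Fin d → ℝ) × (Fin d → ℝ) → (Fin d → ℝ)
  gW : (Fin d → ℝ) × (Fin d → ℝ) → (Fin d → ℝ)
  continuous_fV : Continuous fV
  continuous_fW : Continuous fW
  continuous_gV : Continuous gV
  continuous_gW : Continuous gW

/-- Embeddings in `ℝ^d` of the constraint nodes and of the variable nodes. -/
abbrev Embedding (V W : Type*) (d : ℕ) := (V → Fin d → ℝ) × (W → Fin d → ℝ)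

/-- One update: each node combines its embedding with the weighted sum of the messages of the
nodes on the other side; both sides are updated at the same time. -/
def Layer.update {V W : Type*} [Fintype V] [Fintype W] {a b d : ℕ} (L : Layer d)
    (G : BipGraph V W a b) (h : Embedding V W d) : Embedding V W d :=
  (fun i => L.gV (h.1 i, ∑ j, G.E i j • L.fW (h.2 j)),
   fun j => L.gW (h.2 j, ∑ i, G.E i j • L.fV (h.1 i)))

/-- A GNN for bipartite graphs with features of dimensions `a` and `b`: an embedding dimension,
the input functions, any finite number of update layers, and the output function. The learnable
functions range over the continuous functions. -/
structure GNN (a b : ℕ) where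
  d : ℕ
  inV : (Fin a → ℝ) → (Fin d → ℝ)
  inW : (Fin b → ℝ) → (Fin d → ℝ)
  layers : List (Layer d)
  out : (Fin d → ℝ) × (Fin d → ℝ) → ℝ
  continuous_inV : Continuous inV
  continuous_inW : Continuous inW
  continuous_out : Continuous out

/-- The embeddings of the nodes of `G` at the last layer. -/
def GNN.embed {V W : Type*} [Fintype V] [Fintype W] {a b : ℕ} (N : GNN a b)
    (G : BipGraph V W a b) : Embedding V W N.d :=
  N.layers.foldl (fun h L => L.update G h)
    (fun i => N.inV (G.featV i), fun j => N.inW (G.featW j))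

/-- The graph-level output. -/
def GNN.output {V W : Type*} [Fintype V] [Fintype W] {a b : ℕ} (N : GNN a b)
    (G : BipGraph V W a b) : ℝ :=
  N.out (∑ i, (N.embed G).1 i, ∑ j, (N.embed G).2 j)

/-! ### Random node initialisation -/

/-- The uniform distribution on `[0,1]`. -/
def uniform01 : Measure ℝ := (volume : Measure ℝ).restrict (Set.Icc 0 1)

instance : IsProbabilityMeasure uniform01 := ⟨by simp [uniform01]⟩

/-- The sample space of the random node initialisation of the graph of `φ`: one real number for
each node. -/
abbrev KCNF.Sample {P : Type*} [DecidableEq P] {k n m : ℕ} (φ : KCNF P k n m) :=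
  φ.Constr ⊕ φ.Var → ℝ

/-- The law of the random node initialisation: independent values, uniform on `[0,1]`. -/
def KCNF.rni {P : Type*} [DecidableEq P] {k n m : ℕ} (φ : KCNF P k n m) : Measure φ.Sample :=
  Measure.pi fun _ => uniform01

/-- The mappings computed by GNNs with random node initialisation: to each formula `φ` such a
mapping assigns a random variable on the sample space of `φ`, namely the output of one and the
same GNN on the graph of `φ` with the random values appended to the node features. -/
def RNIGNN (P : Type*) [DecidableEq P] (k n m : ℕ) :
    Set ((φ : KCNF P k n m) → φ.Sample → ℝ) :=
  {F | ∃ N : GNN 2 1, ∀ φ ω, F φ ω = N.output (φ.graph.addFeature ω)}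

open Classical in
/-- The class predicted from the output `y`: `1` if `y > 1/2` and `0` otherwise. -/
def predict (y : ℝ) : Fin 2 := if y > 1 / 2 then 1 else 0

end MilpSat

end

namespace MilpSat

open Topology

variable {P : Type*} [DecidableEq P] {k n m : ℕ}

/-! The random values of the variable nodes serve as names of the letters. A continuous `f` turns
them into an assignment with values `f (x p)`, and one message-passing layer computes its total
violation. If `φ` is satisfiable, `ψ` is not, and the values on `φ` are distinct, some `f` encodes a
model of `φ` while taking only the values `±1` on the values of `ψ`: the violation is then zero on
`φ` and positive on `ψ` (`KCNF.exists_violation_ne`). The values are almost surely distinct, so up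
to probability `ε` they lie in a compact set of injective samples. By compactness finitely many `f`
separate all pairs from `D`. The vectors of violations then form two disjoint compact sets, and
Urysohn's lemma supplies the output function. -/

/-- The truth value of a letter, or the value of a literal, as a sign. -/
def boolSign (b : Bool) : ℝ := if b = true then 1 else -1

/-- No letter occurs twice in a clause, so at most one summand is nonzero. The sum form allows
exchanging letters and literals below. -/
lemma KCNF.milp_A_eq_sum (φ : KCNF P k n m) (C : φ.Constr) (p : φ.Var) :
    φ.milp.A C p = ∑ l ∈ C.1, if l.1 = p.1 then boolSign l.2 else 0 := by
  have hC := (φ.isKClause C.1 C.2).2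
  have key : ∀ b : Bool, (p.1, b) ∈ C.1 →
      (∑ l ∈ C.1, if l.1 = p.1 then boolSign l.2 else 0) = boolSign b := by
    intro b hb
    rw [Finset.sum_eq_single_of_mem _ hb]
    · simp
    · intro l hl hne
      rw [if_neg]
      exact fun h => hne (hC l hl _ hb h)
  by_cases ht : (p.1, true) ∈ C.1
  · rw [key true ht]
    simp [KCNF.milp, ht, boolSign]
  by_cases hf : (p.1, false) ∈ C.1
  · rw [key false hf]
    simp [KCNF.milp, ht, hf, boolSign]
  · rw [Finset.sum_eq_zero]
    · simp [KCNF.milp, ht, hf]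
    · rintro ⟨q, b⟩ hl
      rw [if_neg]
      rintro rfl
      cases b
      · exact hf hl
      · exact ht hl

lemma mem_letters {φ : Finset (Clause P)} {C : Clause P} (hC : C ∈ φ) {l : Literal P}
    (hl : l ∈ C) : l.1 ∈ letters φ :=
  Finset.mem_biUnion.2 ⟨C, hC, Finset.mem_image_of_mem _ hl⟩

/-- At a world, the left-hand side of the constraint of a clause (in `±1`-variables) is the number
of true literals minus the number of false literals. -/
lemma KCNF.sum_milp_A_mul_boolSign (φ : KCNF P k n m) (C : φ.Constr) (w : P → Bool) :
    ∑ p, φ.milp.A C p * boolSign (w p.1) = ∑ l ∈ C.1, if w l.1 = l.2 then (1 : ℝ) else -1 := by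
  simp_rw [φ.milp_A_eq_sum, Finset.sum_mul]
  rw [Finset.sum_comm]
  refine Finset.sum_congr rfl fun l hl => ?_
  rw [Finset.sum_eq_single_of_mem ⟨l.1, mem_letters C.2 hl⟩ (Finset.mem_univ _)]
  · rcases l with ⟨q, b⟩
    cases b <;> cases w q <;> simp [boolSign]
  · intro p _ hne
    rw [if_neg, zero_mul]
    exact fun h => hne (Subtype.ext h.symm)

/-- The total violation of the constraints when the variable `p` is assigned `f (x p)`. -/
def KCNF.violation (φ : KCNF P k n m) (f : C(ℝ, ℝ)) (x : φ.Sample) : ℝ :=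
  -- For `±1` assignments the inner sum is true minus false literals, so adding `k` gives twice the
  -- number of true ones.
  ∑ C, max 0 (1 - (∑ p, φ.milp.A C p * f (x (Sum.inr p)) + k))

lemma KCNF.continuous_violation (φ : KCNF P k n m) (f : C(ℝ, ℝ)) :
    Continuous (φ.violation f) := by
  unfold KCNF.violation
  fun_prop

lemma KCNF.violation_eq_zero (φ : KCNF P k n m) {f : C(ℝ, ℝ)} {x : φ.Sample} {w : P → Bool}
    (hw : Models w φ.clauses) (hf : ∀ p : φ.Var, f (x (Sum.inr p)) = boolSign (w p.1)) :
    φ.violation f x = 0 := by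
  refine Finset.sum_eq_zero fun C _ => max_eq_left ?_
  simp_rw [hf]
  rw [φ.sum_milp_A_mul_boolSign]
  have hk : (C.1.card : ℝ) = k := mod_cast (φ.isKClause C.1 C.2).1
  obtain ⟨l, hl, hwl⟩ := hw C.1 C.2
  have h : (2 : ℝ) ≤ ∑ l ∈ C.1, ((if w l.1 = l.2 then (1 : ℝ) else -1) + 1) := by
    refine le_trans ?_ (Finset.single_le_sum (fun l _ => ?_) hl)
    · rw [if_pos hwl]; norm_num
    · split_ifs <;> norm_num
  rw [Finset.sum_add_distrib, Finset.sum_const, nsmul_one] at h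
  linarith

lemma KCNF.violation_pos (φ : KCNF P k n m) {f : C(ℝ, ℝ)} {x : φ.Sample} {w : P → Bool}
    (hw : ¬ Models w φ.clauses) (hf : ∀ p : φ.Var, f (x (Sum.inr p)) = boolSign (w p.1)) :
    0 < φ.violation f x := by
  simp only [Models, not_forall, not_exists, not_and] at hw
  obtain ⟨C, hC, hCw⟩ := hw
  refine Finset.sum_pos' (fun _ _ => le_max_left _ _)
    ⟨⟨C, hC⟩, Finset.mem_univ _, lt_max_of_lt_right ?_⟩
  simp_rw [hf]
  have hk : (C.card : ℝ) = k := mod_cast (φ.isKClause C hC).1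
  rw [φ.sum_milp_A_mul_boolSign ⟨C, hC⟩, ← hk,
    Finset.sum_congr rfl fun l hl => if_neg (hCw l hl)]
  simp

lemma exists_continuousMap_boolSign {S T : Set ℝ} (hS : S.Finite) (hT : T.Finite)
    (hST : Disjoint S T) :
    ∃ f : C(ℝ, ℝ), (∀ x ∈ S, f x = 1) ∧ ∀ x ∈ T, f x = -1 := by
  obtain ⟨f, h0, h1, -⟩ := exists_continuous_zero_one_of_isClosed hT.isClosed hS.isClosed hST.symm
  refine ⟨f + f - 1, fun x hx => ?_, fun x hx => ?_⟩
  · simp [h1 hx]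
  · simp [h0 hx]

/-- A satisfiable and an unsatisfiable formula are told apart by the violation of an assignment. -/
lemma KCNF.exists_violation_ne (φ ψ : KCNF P k n m) (hφ : Satisfiable φ.clauses)
    (hψ : ¬ Satisfiable ψ.clauses) {x : φ.Sample} (hx : Function.Injective x) (y : ψ.Sample) :
    ∃ f : C(ℝ, ℝ), φ.violation f x ≠ ψ.violation f y := by
  classical
  obtain ⟨w, hw⟩ := hφ
  let S : Set ℝ := (fun p : φ.Var => x (Sum.inr p)) '' {p | w p.1 = true}
  let X : Set ℝ := Set.range x ∪ Set.range y
  have hX : X.Finite := (Set.finite_range x).union (Set.finite_range y)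
  obtain ⟨f, hf1, hf0⟩ := exists_continuousMap_boolSign (S := S) (T := X \ S)
    -- `f` is `-1` on all the other values of both samples, so it is `±1` on those of `ψ` too.
    (Set.toFinite _) (hX.subset Set.sdiff_subset) Set.disjoint_sdiff_right
  have hf : ∀ z ∈ X, f z = boolSign (decide (z ∈ S)) := by
    intro z hz
    by_cases h : z ∈ S
    · simp [boolSign, h, hf1 z h]
    · simp [boolSign, h, hf0 z ⟨hz, h⟩]
  refine ⟨f, ?_⟩
  rw [φ.violation_eq_zero hw (f := f)]
  -- The world is read off from the values, so `y` need not be injective.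
  · refine (ψ.violation_pos (f := f) (w := fun p => if hp : p ∈ letters ψ.clauses then
      decide (y (Sum.inr ⟨p, hp⟩) ∈ S) else false) (fun h => hψ ⟨_, h⟩) fun p => ?_).ne
    rw [hf _ (Or.inr ⟨_, rfl⟩), dif_pos p.2]
  · intro p
    rw [hf _ (Or.inl ⟨_, rfl⟩)]
    have : x (Sum.inr p) ∈ S ↔ w p.1 = true := by
      constructor
      · rintro ⟨q, hq, hqp⟩
        -- Injectivity of `x` keeps letters of different truth value apart.
        rwa [← Sum.inr_injective (hx hqp)]
      · exact fun h => ⟨p, h, rfl⟩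
    simp [this]

/-- The one-layer network that computes the violations of the assignments `f r`. -/
def violationGNN (k : ℕ) {d : ℕ} (f : Fin d → C(ℝ, ℝ)) (o : C(Fin d → ℝ, ℝ)) : GNN 2 1 where
  d := d
  -- The right-hand side of a constraint is not needed: in `±1` variables it depends on `k` only.
  inV := fun _ => 0
  inW := fun x r => f r (x 0)
  layers := [{
    fV := id
    fW := id
    gV := fun h r => max 0 (1 - (h.2 r + k))
    gW := Prod.fst
    continuous_fV := continuous_id
    continuous_fW := continuous_id
    continuous_gV := by fun_prop
    continuous_gW := continuous_fst }]
  out := fun h => o h.1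
  continuous_inV := continuous_const
  continuous_inW := by fun_prop
  continuous_out := by fun_prop

lemma violationGNN_output {d : ℕ} (f : Fin d → C(ℝ, ℝ)) (o : C(Fin d → ℝ, ℝ))
    (φ : KCNF P k n m) (x : φ.Sample) :
    (violationGNN k f o).output (φ.graph.addFeature x) = o fun r => φ.violation (f r) x := by
  change o _ = o _
  congr 1
  funext r
  refine (Finset.sum_apply (M := fun _ : Fin d => ℝ) r _ _).trans
    (Finset.sum_congr rfl fun C _ => ?_)
  change max 0 (1 - ((∑ p, φ.milp.A C p • fun r : Fin d => f r (x (Sum.inr p))) r + (k : ℝ))) = _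
  simp [Finset.sum_apply]

/-- Each coincidence `x i = x j` with `i ≠ j` defines a proper subspace, which is Lebesgue-null. -/
lemma ae_injective_pi {ι : Type*} [Fintype ι] :
    ∀ᵐ x ∂(Measure.pi fun _ : ι => uniform01), Function.Injective x := by
  classical
  have h : ∀ i j : ι, i ≠ j → ∀ᵐ x ∂(Measure.pi fun _ : ι => uniform01), x i ≠ x j := by
    intro i j hij
    unfold uniform01
    rw [← Measure.restrict_pi_pi (fun _ : ι => (volume : Measure ℝ)), ← volume_pi]
    refine ae_restrict_of_ae ?_
    let L : (ι → ℝ) →ₗ[ℝ] ℝ :=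
      (LinearMap.proj i : (ι → ℝ) →ₗ[ℝ] ℝ) - (LinearMap.proj j : (ι → ℝ) →ₗ[ℝ] ℝ)
    have hL : LinearMap.ker L ≠ ⊤ := by
      intro h
      have : (Pi.single i 1 : ι → ℝ) ∈ LinearMap.ker L := h ▸ Submodule.mem_top
      simp [L, hij.symm] at this
    have h0 := Measure.addHaar_submodule (volume : Measure (ι → ℝ)) _ hL
    rw [ae_iff]
    refine measure_mono_null (fun x hx => ?_) h0
    simpa [L, sub_eq_zero] using hx
  have h' : ∀ᵐ x ∂(Measure.pi fun _ : ι => uniform01), ∀ i j : ι, i ≠ j → x i ≠ x j :=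
    ae_all_iff.2 fun i => ae_all_iff.2 fun j => by
      by_cases hij : i = j
      · simp [hij]
      · filter_upwards [h i j hij] with x hx _ using hx
  filter_upwards [h'] with x hx i j hxij
  by_contra hij
  exact hx i j hij hxij

lemma isOpen_setOf_injective {ι : Type*} [Finite ι] :
    IsOpen {x : ι → ℝ | Function.Injective x} := by
  have : {x : ι → ℝ | Function.Injective x} = ⋂ i, ⋂ j, {x | i ≠ j → x i ≠ x j} := by
    ext x
    simp only [Set.mem_ofPred_eq, Set.mem_iInter, ne_eq, not_imp_not]
    rfl
  rw [this]
  refine isOpen_iInter_of_finite fun i => isOpen_iInter_of_finite fun j => ?_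
  by_cases hij : i = j
  · simp [hij]
  · simpa [hij] using isOpen_ne_fun (continuous_apply i) (continuous_apply j)

/-- With probability close to `1`, a random node initialisation lies in a compact set of injective
ones. -/
lemma KCNF.exists_isCompact_injective (φ : KCNF P k n m) {ε : ℝ} (hε : 0 < ε) :
    ∃ K : Set φ.Sample, IsCompact K ∧ (∀ x ∈ K, Function.Injective x) ∧
      φ.rni Kᶜ < ENNReal.ofReal ε := by
  have : IsProbabilityMeasure φ.rni := by unfold KCNF.rni; infer_instance
  obtain ⟨K, hKU, hK, hlt⟩ := (isOpen_setOf_injective (ι := φ.Constr ⊕ φ.Var)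
    ).measurableSet.exists_isCompact_sdiff_lt (μ := φ.rni) (measure_ne_top _ _)
    (ENNReal.ofReal_pos.2 hε).ne'
  refine ⟨K, hK, hKU, lt_of_le_of_lt ?_ hlt⟩
  refine measure_mono_ae ?_
  have := ae_injective_pi (ι := φ.Constr ⊕ φ.Var)
  filter_upwards [this] with x hx hxK using ⟨hx, hxK⟩

/-- Finitely many assignments tell apart all the pairs of samples in two compact sets. -/
lemma KCNF.exists_finset_violation_ne (φ ψ : KCNF P k n m) (hφ : Satisfiable φ.clauses)
    (hψ : ¬ Satisfiable ψ.clauses) {K : Set φ.Sample} {K' : Set ψ.Sample} (hK : IsCompact K)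
    (hK' : IsCompact K') (hinj : ∀ x ∈ K, Function.Injective x) :
    ∃ T : Finset C(ℝ, ℝ), ∀ x ∈ K, ∀ y ∈ K', ∃ f ∈ T, φ.violation f x ≠ ψ.violation f y := by
  obtain ⟨T, hT⟩ := (hK.prod hK').elim_finite_subcover
    (fun f : C(ℝ, ℝ) => {z : φ.Sample × ψ.Sample | φ.violation f z.1 ≠ ψ.violation f z.2})
    (fun f => isOpen_ne_fun ((φ.continuous_violation f).comp continuous_fst)
      ((ψ.continuous_violation f).comp continuous_snd))
    (fun z hz => Set.mem_iUnion.2 (φ.exists_violation_ne ψ hφ hψ (hinj _ hz.1) z.2))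
  refine ⟨T, fun x hx y hy => ?_⟩
  simpa using hT (Set.mk_mem_prod hx hy)

end MilpSat

open MilpSat in
theorem mainTheorem1 {P : Type*} [DecidableEq P] (k n m : ℕ)
    (D : Finset (MilpSat.KCNF P k n m)) (ε : ℝ) (hε : 0 < ε) :
    ∃ F ∈ MilpSat.RNIGNN P k n m, ∀ φ ∈ D,
      φ.rni {ω | MilpSat.predict (F φ ω) ≠ MilpSat.satLabel φ} < ENNReal.ofReal ε := by
  classical
  choose K hK hinj hlt using fun φ : KCNF P k n m => φ.exists_isCompact_injective hε
  have hT : ∀ φ ψ : KCNF P k n m, ∃ T : Finset C(ℝ, ℝ), Satisfiable φ.clauses →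
      ¬ Satisfiable ψ.clauses → ∀ x ∈ K φ, ∀ y ∈ K ψ, ∃ f ∈ T,
        φ.violation f x ≠ ψ.violation f y := by
    intro φ ψ
    by_cases h : Satisfiable φ.clauses ∧ ¬ Satisfiable ψ.clauses
    · obtain ⟨T, hT⟩ := φ.exists_finset_violation_ne ψ h.1 h.2 (hK φ) (hK ψ) (hinj φ)
      exact ⟨T, fun _ _ => hT⟩
    · exact ⟨∅, fun h1 h2 => (h ⟨h1, h2⟩).elim⟩
  choose T hT using hT
  let U : Finset C(ℝ, ℝ) := D.biUnion fun φ => D.biUnion fun ψ => T φ ψ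
  let f : Fin U.card → C(ℝ, ℝ) := fun r => (U.equivFin.symm r).1
  let Y : (φ : KCNF P k n m) → φ.Sample → Fin U.card → ℝ := fun φ x r => φ.violation (f r) x
  have hY : ∀ φ, IsCompact (Y φ '' K φ) := fun φ =>
    (hK φ).image (continuous_pi fun r => φ.continuous_violation (f r))
  -- The violation vectors of the satisfiable (`s = True`) or unsatisfiable (`s = False`) formulae
  -- of `D`.
  let A (s : Prop) : Set (Fin U.card → ℝ) :=
    ⋃ φ ∈ D.filter (fun φ => Satisfiable φ.clauses ↔ s), Y φ '' K φ
  have hA : ∀ s, IsClosed (A s) := fun s =>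
    ((Finset.finite_toSet _).isCompact_biUnion fun φ _ => hY φ).isClosed
  have hmem : ∀ φ ∈ D, ∀ x ∈ K φ, ∀ s, (Satisfiable φ.clauses ↔ s) → Y φ x ∈ A s :=
    fun φ hφ x hx s hs => Set.mem_biUnion (Finset.mem_filter.2 ⟨hφ, hs⟩) ⟨x, hx, rfl⟩
  have hdisj : Disjoint (A False) (A True) := by
    rw [Set.disjoint_left]
    intro z h0 h1
    simp only [A, Set.mem_iUnion, Finset.mem_filter, iff_false, iff_true] at h0 h1
    obtain ⟨ψ, ⟨hψ, hψs⟩, y, hy, rfl⟩ := h0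
    obtain ⟨φ, ⟨hφ, hφs⟩, x, hx, hxy⟩ := h1
    obtain ⟨g, hg, hne⟩ := hT φ ψ hφs hψs x hx y hy
    have hgU : g ∈ U := Finset.mem_biUnion.2 ⟨φ, hφ, Finset.mem_biUnion.2 ⟨ψ, hψ, hg⟩⟩
    have := congrFun hxy (U.equivFin ⟨g, hgU⟩)
    simp only [Y, f, Equiv.symm_apply_apply] at this
    exact hne this
  obtain ⟨o, ho0, ho1, -⟩ := exists_continuous_zero_one_of_isClosed (hA _) (hA _) hdisj
  refine ⟨fun φ x => (violationGNN k f o).output (φ.graph.addFeature x), ⟨_, fun _ _ => rfl⟩,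
    -- On `K φ` the output is exactly the label, so errors occur only outside `K φ`.
    fun φ hφ => lt_of_le_of_lt (measure_mono (t := (K φ)ᶜ) fun x hx hxK => hx ?_) (hlt φ)⟩
  dsimp only
  rw [violationGNN_output]
  by_cases hs : Satisfiable φ.clauses
  · have h : o (Y φ x) = 1 := ho1 (hmem φ hφ x hxK _ (iff_true_intro hs))
    change predict (o (Y φ x)) = _
    rw [h, satLabel, if_pos hs, predict, if_pos (by norm_num)]
  · have h : o (Y φ x) = 0 := ho0 (hmem φ hφ x hxK _ (iff_false_intro hs))
    change predict (o (Y φ x)) = _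
    rw [h, satLabel, if_neg hs, predict, if_neg (by norm_num)]
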